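/- Let $f:\mathbb{R}^D\to\mathbb{R}$ be continuous with effective dimensionality $d_e\le d$ and effective subspace $\mathcal{T}$; that is, $\mathcal{T}$ is a linear subspace of dimension $d_e$ with $f(x_\top+x_\perp)=f(x_\top)$ for all $x_\top\in\mathcal{T}$, $x_\perp\in\mathcal{T}^\perp$, and no subspace of smaller dimension has this property. Let $x^*$ be a global minimizer of $f$ on $\mathbb{R}^D$ whose orthogonal projection $x_\top^*$ onto $\mathcal{T}$ is nonzero, and let $\mathcal{G}^*=x_\top^*+\mathcal{T}^\perp$. Let $A$ be a $D\times d$ Gaussian random matrix (independent standard normal entries) and $S^*=\{y\in\mathbb{R}^d: Ay\in\mathcal{G}^*\}$. Then, with probability one, $S^*$ has a unique element of least Euclidean norm, and the random vector $y_2^*=\operatorname{argmin}_{y\in S^*}\|y\|_2$ (determined almost surely) has a probability density function with respect to Lebesgue measure on $\mathbb{R}^d$, given for almost every $y$ by $$g^*(y)=\pi^{-d/2}\,\frac{\Gamma(d/2)}{\Gamma(n/2)}\left(\frac{\|x_\top^*\|}{\sqrt2}\right)^{n}(y^Ty)^{-(n+d)/2}\exp\!\left(-\frac{\|x_\top^*\|^2}{2\,y^Ty}\right),\qquad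 n=d-d_e+1.$$ -/

import Mathlib

open MeasureTheory ProbabilityTheory
open scoped Matrix

/-- `f` does not vary along `Tᗮ`: `f (x_⊤ + x_⊥) = f x_⊤` for all `x_⊤ ∈ T`, `x_⊥ ∈ Tᗮ`. -/
def IsConstantAlongOrthogonal {D : ℕ} (f : EuclideanSpace ℝ (Fin D) → ℝ)
    (T : Submodule ℝ (EuclideanSpace ℝ (Fin D))) : Prop :=
  ∀ xT ∈ T, ∀ xp ∈ Tᗮ, f (xT + xp) = f xT

/-- `f` has effective dimensionality `de` with effective subspace `T`: `T` has dimension `de`,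
`f` does not vary along `Tᗮ`, and `de` is the smallest dimension of a subspace with this
property. -/
structure IsEffectiveSubspace {D : ℕ} (f : EuclideanSpace ℝ (Fin D) → ℝ) (de : ℕ)
    (T : Submodule ℝ (EuclideanSpace ℝ (Fin D))) : Prop where
  finrank_eq : Module.finrank ℝ T = de
  constant : IsConstantAlongOrthogonal f T
  minimal : ∀ T' : Submodule ℝ (EuclideanSpace ℝ (Fin D)),
    IsConstantAlongOrthogonal f T' → de ≤ Module.finrank ℝ T'

/-- A Gaussian random matrix: its entries are independent standard normal random variables. -/
structure IsGaussianMatrix {Ω : Type*} [MeasurableSpace Ω] {D d : ℕ}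
    (A : Ω → Matrix (Fin D) (Fin d) ℝ) (P : Measure Ω) : Prop where
  hasLaw : ∀ i j, HasLaw (fun ω => A ω i j) (gaussianReal 0 1) P
  indep : iIndepFun (fun (p : Fin D × Fin d) ω => A ω p.1 p.2) P

/-- The affine subspace `G* = x_⊤* + Tᗮ`, where `x_⊤*` is the orthogonal projection of `xs`
onto `T`. -/
def minimizerAffineSubspace {D : ℕ} (T : Submodule ℝ (EuclideanSpace ℝ (Fin D)))
    (xs : EuclideanSpace ℝ (Fin D)) : Set (EuclideanSpace ℝ (Fin D)) :=
  {x | ∃ v ∈ Tᗮ, x = T.starProjection xs + v}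

/-- The set `S* = {y : A y ∈ G*}`. -/
def reducedMinimizers {D d : ℕ} (A : Matrix (Fin D) (Fin d) ℝ)
    (T : Submodule ℝ (EuclideanSpace ℝ (Fin D))) (xs : EuclideanSpace ℝ (Fin D)) :
    Set (EuclideanSpace ℝ (Fin d)) :=
  {y | WithLp.toLp 2 (A *ᵥ y.ofLp) ∈ minimizerAffineSubspace T xs}

/-- `y` is an element of `S` of least Euclidean norm. -/
def IsMinimalNormElement {d : ℕ} (S : Set (EuclideanSpace ℝ (Fin d)))
    (y : EuclideanSpace ℝ (Fin d)) : Prop :=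
  y ∈ S ∧ ∀ y' ∈ S, ‖y‖ ≤ ‖y'‖

/-- The function `g*(y)`, with `r` in place of `‖x_⊤*‖`; here `n = d - de + 1` is computed in
`ℝ` and `inner ℝ y y` is `yᵀ y`. -/
noncomputable def gStar {d : ℕ} (de : ℕ) (r : ℝ) (y : EuclideanSpace ℝ (Fin d)) : ℝ :=
  let n : ℝ := (d : ℝ) - (de : ℝ) + 1
  Real.pi ^ (-(d : ℝ) / 2) * (Real.Gamma ((d : ℝ) / 2) / Real.Gamma (n / 2)) *
    (r / Real.sqrt 2) ^ n * (inner ℝ y y : ℝ) ^ (-(n + (d : ℝ)) / 2) *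
    Real.exp (-r ^ 2 / (2 * (inner ℝ y y : ℝ)))

/-! Take an orthonormal basis of `T` whose last vector is `x_⊤*/r`, where `r = ‖x_⊤*‖`. Then `A y ∈
G*` says that `y` is orthogonal to every row combination of `A` along this basis except the last,
with which its inner product is `r`. These `de = m + 1` combinations are independent standard
Gaussian vectors (`IsGaussianMatrix.map_rowCombination`). Almost surely the unique least-norm
solution is `(r/‖w‖²) w`, with `w` the last Gram-Schmidt vector
(`existsUnique_isMinimalNormElement`).

Its law is rotation invariant, as Gram-Schmidt commutes with isometries. Given the first `m`
vectors, `w` is standard Gaussian on a space of dimension `n = d - m`, so the norm of the solution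
is distributed as `r/χ_n` (`map_norm_map_minNormSolution`). A rotation invariant finite measure is
determined by its norm law (`eq_of_map_norm_eq_of_rotation_invariant`), so it remains to match norm
laws with the radial density `g*`, by polar coordinates and `ρ = r/s`. -/

/-! ### Standard Gaussian measure: projections, density, polar coordinates. -/

section StdGaussian

variable {E F : Type*} [NormedAddCommGroup E] [InnerProductSpace ℝ E] [FiniteDimensional ℝ E]
  [MeasurableSpace E] [BorelSpace E] [NormedAddCommGroup F] [InnerProductSpace ℝ F]
  [FiniteDimensional ℝ F] [MeasurableSpace F] [BorelSpace F]

/-- A coisometry maps the standard Gaussian measure to the standard Gaussian measure. -/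
lemma stdGaussian_map_of_norm_adjoint (L : E →L[ℝ] F)
    (hL : ∀ t, ‖ContinuousLinearMap.adjoint L t‖ = ‖t‖) :
    (stdGaussian E).map L = stdGaussian F := by
  apply Measure.ext_of_charFun
  ext t
  rw [charFun_stdGaussian, ← hL, ← charFun_stdGaussian, charFun_apply, charFun_apply,
    integral_map (by fun_prop) (by fun_prop)]
  simp_rw [ContinuousLinearMap.adjoint_inner_right]

/-- The density of the standard Gaussian measure. -/
noncomputable def stdGaussianDensity (n : ℕ) (ρ : ℝ) : ℝ :=
  (2 * Real.pi) ^ (-(n : ℝ) / 2) * Real.exp (-ρ ^ 2 / 2)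

lemma stdGaussianDensity_nonneg (n : ℕ) (ρ : ℝ) : 0 ≤ stdGaussianDensity n ρ := by
  unfold stdGaussianDensity; positivity

@[fun_prop]
lemma continuous_stdGaussianDensity (n : ℕ) : Continuous (stdGaussianDensity n) := by
  unfold stdGaussianDensity; fun_prop

lemma integrable_stdGaussianDensity :
    Integrable (fun x : E => stdGaussianDensity (Module.finrank ℝ E) ‖x‖) := by
  have h := GaussianFourier.integrable_cexp_neg_mul_sq_norm_add (V := E) (b := 1 / 2)
    (by norm_num) 0 0
  refine (h.norm.const_mul
    ((2 * Real.pi) ^ (-(Module.finrank ℝ E : ℝ) / 2))).congr (.of_forall fun x => ?_)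
  simp only [stdGaussianDensity, Complex.norm_exp]
  congr 2
  norm_num [← Complex.ofReal_pow]
  ring

lemma charFun_withDensity_stdGaussianDensity (t : E) :
    charFun ((volume : Measure E).withDensity
      fun x => ENNReal.ofReal (stdGaussianDensity (Module.finrank ℝ E) ‖x‖)) t
      = Complex.exp (-‖t‖ ^ 2 / 2) := by
  rw [charFun_apply, integral_withDensity_eq_integral_toReal_smul (by fun_prop) (by simp)]
  have h := GaussianFourier.integral_cexp_neg_mul_sq_norm_add (V := E) (b := 1 / 2)
    (by norm_num) Complex.I t
  have hc : (((2 * Real.pi) ^ (-(Module.finrank ℝ E : ℝ) / 2) : ℝ) : ℂ) *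
      (Real.pi / (1 / 2 : ℂ)) ^ (Module.finrank ℝ E / 2 : ℂ) = 1 := by
    rw [show (Real.pi / (1 / 2 : ℂ)) = ((2 * Real.pi : ℝ) : ℂ) by push_cast; ring,
      show (Module.finrank ℝ E / 2 : ℂ) = ((Module.finrank ℝ E / 2 : ℝ) : ℂ) by push_cast; ring,
      ← Complex.ofReal_cpow (by positivity), ← Complex.ofReal_mul,
      ← Real.rpow_add (by positivity)]
    simp [neg_div]
  calc _ = ∫ x : E, (((2 * Real.pi) ^ (-(Module.finrank ℝ E : ℝ) / 2) : ℝ) : ℂ) *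
        Complex.exp (-(1 / 2) * ‖x‖ ^ 2 + Complex.I * inner ℝ t x) := by
        congr 1; ext x
        rw [ENNReal.toReal_ofReal (stdGaussianDensity_nonneg _ _), stdGaussianDensity,
          Complex.real_smul, Complex.ofReal_mul, mul_assoc, Complex.ofReal_exp, ← Complex.exp_add,
          real_inner_comm]
        congr 2
        push_cast
        ring
    _ = _ := by
        rw [integral_const_mul, h, ← mul_assoc, hc, one_mul]
        congr 1
        simp
        ring

lemma stdGaussian_eq_withDensity :
    stdGaussian E = (volume : Measure E).withDensity
      fun x => ENNReal.ofReal (stdGaussianDensity (Module.finrank ℝ E) ‖x‖) := by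
  have := isFiniteMeasure_withDensity_ofReal
    (integrable_stdGaussianDensity (E := E)).hasFiniteIntegral
  apply Measure.ext_of_charFun
  ext t
  rw [charFun_stdGaussian, charFun_withDensity_stdGaussianDensity]

lemma stdGaussian_absolutelyContinuous : stdGaussian E ≪ (volume : Measure E) := by
  rw [stdGaussian_eq_withDensity]
  exact withDensity_absolutelyContinuous _ _

lemma stdGaussian_submodule_eq_zero (S : Submodule ℝ E) (hS : S ≠ ⊤) :
    stdGaussian E (S : Set E) = 0 :=
  stdGaussian_absolutelyContinuous (Measure.addHaar_submodule _ S hS)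

lemma lintegral_fun_norm_addHaar [Nontrivial E] (μ : Measure E) [μ.IsAddHaarMeasure]
    {f : ℝ → ENNReal} (hf : Measurable f) :
    ∫⁻ x, f ‖x‖ ∂μ = Module.finrank ℝ E * μ (Metric.ball 0 1) *
      ∫⁻ y in Set.Ioi (0 : ℝ), ENNReal.ofReal (y ^ (Module.finrank ℝ E - 1)) * f y :=
  calc
    ∫⁻ x, f (‖x‖) ∂μ = ∫⁻ x : ({(0)}ᶜ : Set E), f (‖x.1‖) ∂(μ.comap (↑)) := by
      rw [lintegral_subtype_comap (measurableSet_singleton _).compl fun x ↦ f (‖x‖),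
        restrict_compl_singleton]
    _ = ∫⁻ x, f x.2 ∂μ.toSphere.prod (.volumeIoiPow (Module.finrank ℝ E - 1)) := by
      rw [← μ.measurePreserving_homeomorphUnitSphereProd.lintegral_comp_emb
        (Homeomorph.measurableEmbedding _)]
      simp
    _ = μ.toSphere Set.univ *
        ∫⁻ x : Set.Ioi (0 : ℝ), f x ∂.volumeIoiPow (Module.finrank ℝ E - 1) := by
      rw [lintegral_prod _ (by fun_prop)]
      simp [mul_comm]
    _ = _ := by
      rw [Measure.volumeIoiPow, lintegral_withDensity_eq_lintegral_mul _ (by fun_prop)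
        (by fun_prop), μ.toSphere_apply_univ]
      congr 1
      exact lintegral_subtype_comap measurableSet_Ioi
        fun y => ENNReal.ofReal (y ^ (Module.finrank ℝ E - 1)) * f y

end StdGaussian

/-! ### Rotation invariant measures and their norm laws. -/

section RotationInvariant

variable {E : Type*} [NormedAddCommGroup E] [InnerProductSpace ℝ E]

lemma exists_linearIsometryEquiv_apply_eq {v w : E} (h : ‖v‖ = ‖w‖) :
    ∃ U : E ≃ₗᵢ[ℝ] E, U v = w :=
  ⟨_, Submodule.reflection_sub h⟩

variable [FiniteDimensional ℝ E] [MeasurableSpace E] [BorelSpace E]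

lemma charFun_comp_linearIsometryEquiv {μ : Measure E} (hμ : ∀ U : E ≃ₗᵢ[ℝ] E, μ.map U = μ)
    (U : E ≃ₗᵢ[ℝ] E) (t : E) : charFun μ (U t) = charFun μ t := by
  conv_lhs => rw [← hμ U]
  rw [charFun_apply, charFun_apply, integral_map (by fun_prop) (by fun_prop)]
  simp

lemma charFun_eq_of_norm_eq {μ : Measure E} (hμ : ∀ U : E ≃ₗᵢ[ℝ] E, μ.map U = μ)
    {s t : E} (hst : ‖s‖ = ‖t‖) : charFun μ s = charFun μ t := by
  obtain ⟨U, rfl⟩ := exists_linearIsometryEquiv_apply_eq hst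
  exact (charFun_comp_linearIsometryEquiv hμ U s).symm

/-- The characteristic function of the uniform distribution on a sphere, the latter being written
as the law of a normalized standard Gaussian vector. -/
noncomputable def sphericalCharFun (c : ℝ) (w : E) : ℂ :=
  ∫ x, Complex.exp (inner ℝ w ((c / ‖x‖) • x) * Complex.I) ∂(stdGaussian E)

lemma sphericalCharFun_eq_of_norm_eq (c : ℝ) {v w : E} (h : ‖v‖ = ‖w‖) :
    sphericalCharFun c v = sphericalCharFun c w := by
  obtain ⟨U, rfl⟩ := exists_linearIsometryEquiv_apply_eq h
  unfold sphericalCharFun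
  conv_rhs => rw [← stdGaussian_map U]
  rw [integral_map (by fun_prop) (Measurable.aestronglyMeasurable (by fun_prop))]
  congr 1; ext x
  rw [U.norm_map, ← map_smul, U.inner_map_map]

lemma stronglyMeasurable_sphericalCharFun (c : ℝ) :
    StronglyMeasurable (sphericalCharFun c : E → ℂ) := by
  unfold sphericalCharFun
  exact StronglyMeasurable.integral_prod_right
    (f := fun (w x : E) => Complex.exp (inner ℝ w ((c / ‖x‖) • x) * Complex.I))
    (Measurable.stronglyMeasurable (by fun_prop))

/-- The characteristic function is constant on the sphere of radius `‖t‖`; averaging it over that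
sphere and applying Fubini moves the average onto the exponential. -/
lemma charFun_eq_integral_sphericalCharFun [Nontrivial E] {μ : Measure E} [IsFiniteMeasure μ]
    (hμ : ∀ U : E ≃ₗᵢ[ℝ] E, μ.map U = μ) (t : E) :
    charFun μ t = ∫ w, sphericalCharFun ‖t‖ w ∂μ := by
  have h0 : ∀ᵐ x ∂(stdGaussian E), x ≠ 0 := by
    have := stdGaussian_submodule_eq_zero (⊥ : Submodule ℝ E) bot_ne_top
    simpa [ae_iff] using this
  have h1 : ∀ᵐ x ∂(stdGaussian E), charFun μ ((‖t‖ / ‖x‖) • x) = charFun μ t := by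
    filter_upwards [h0] with x hx
    refine charFun_eq_of_norm_eq hμ ?_
    rw [norm_smul, norm_div, norm_norm, norm_norm, div_mul_cancel₀ _ (norm_ne_zero_iff.2 hx)]
  calc charFun μ t = ∫ x, charFun μ ((‖t‖ / ‖x‖) • x) ∂(stdGaussian E) := by
        rw [integral_congr_ae h1]; simp
    _ = _ := by
        simp_rw [charFun_apply, sphericalCharFun]
        rw [integral_integral_swap]
        refine (integrable_const (1 : ℝ)).mono' ?_ (.of_forall fun p => ?_)
        · exact Measurable.aestronglyMeasurable (by unfold Function.uncurry; fun_prop)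
        · rw [Function.uncurry, Complex.norm_exp_ofReal_mul_I]

/-- A finite rotation invariant measure is determined by the law of the norm. -/
theorem eq_of_map_norm_eq_of_rotation_invariant [Nontrivial E] {μ ν : Measure E}
    [IsFiniteMeasure μ] [IsFiniteMeasure ν]
    (hμ : ∀ U : E ≃ₗᵢ[ℝ] E, μ.map U = μ) (hν : ∀ U : E ≃ₗᵢ[ℝ] E, ν.map U = ν)
    (h : μ.map (‖·‖) = ν.map (‖·‖)) : μ = ν := by
  obtain ⟨e, he⟩ := exists_norm_eq E (zero_le_one (α := ℝ))
  -- `sphericalCharFun c` is radial, so its integral only sees the law of the norm.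
  have key : ∀ (c : ℝ) (σ : Measure E), ∫ w, sphericalCharFun c w ∂σ =
      ∫ ρ, sphericalCharFun c (ρ • e) ∂(σ.map (‖·‖)) := fun c σ => by
    have hm : StronglyMeasurable fun ρ : ℝ => sphericalCharFun c (ρ • e) :=
      (stronglyMeasurable_sphericalCharFun c).comp_measurable (by fun_prop)
    rw [integral_map (by fun_prop) hm.aestronglyMeasurable]
    congr 1; ext w
    exact sphericalCharFun_eq_of_norm_eq c (by simp [norm_smul, he])
  apply Measure.ext_of_charFun
  ext t
  rw [charFun_eq_integral_sphericalCharFun hμ, charFun_eq_integral_sphericalCharFun hν, key, key, h]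

lemma withDensity_fun_norm_map_linearIsometryEquiv (g : E → ENNReal) (hg : Measurable g)
    (hgn : ∀ v w, ‖v‖ = ‖w‖ → g v = g w) (U : E ≃ₗᵢ[ℝ] E) :
    ((volume : Measure E).withDensity g).map U = (volume : Measure E).withDensity g := by
  ext s hs
  rw [Measure.map_apply (by fun_prop) hs, withDensity_apply _ (hs.preimage (by fun_prop)),
    withDensity_apply _ hs, ← U.measurePreserving.setLIntegral_comp_preimage hs hg]
  exact lintegral_congr fun x => hgn _ _ (U.norm_map x).symm

end RotationInvariant

/-! ### The norm law of `g*` as that of `r/χ_n`. -/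

section NormLaw

/-- The radial profile of `gStar`. -/
noncomputable def gStarRadial (d n : ℕ) (r ρ : ℝ) : ℝ :=
  Real.pi ^ (-(d : ℝ) / 2) * (Real.Gamma ((d : ℝ) / 2) / Real.Gamma ((n : ℝ) / 2)) *
    (r / Real.sqrt 2) ^ (n : ℝ) * (ρ ^ 2) ^ (-((n : ℝ) + (d : ℝ)) / 2) *
    Real.exp (-r ^ 2 / (2 * ρ ^ 2))

lemma gStar_eq_gStarRadial {d de n : ℕ} (hn : n + de = d + 1) (r : ℝ)
    (y : EuclideanSpace ℝ (Fin d)) : gStar de r y = gStarRadial d n r ‖y‖ := by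
  have : (d : ℝ) - de + 1 = n := by
    have : (n : ℝ) + de = d + 1 := by exact_mod_cast hn
    linarith
  simp only [gStar, gStarRadial, this, real_inner_self_eq_norm_sq]

@[fun_prop]
lemma measurable_gStarRadial (d n : ℕ) (r : ℝ) : Measurable (gStarRadial d n r) := by
  unfold gStarRadial; fun_prop

/-- Both sides are the area of the unit sphere in dimension `d`, the constant of polar integration.
-/
lemma volume_ball_constant {d : ℕ} (hd : 0 < d) :
    (d : ENNReal) * ENNReal.ofReal (√Real.pi ^ d / Real.Gamma (d / 2 + 1)) =
      ENNReal.ofReal (2 * Real.pi ^ ((d : ℝ) / 2) / Real.Gamma (d / 2)) := by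
  have hd' : (0 : ℝ) < d := by exact_mod_cast hd
  rw [← ENNReal.ofReal_natCast, ← ENNReal.ofReal_mul hd'.le, Real.Gamma_add_one (by positivity),
    Real.sqrt_eq_rpow, ← Real.rpow_natCast, ← Real.rpow_mul Real.pi_pos.le]
  have := Real.Gamma_pos_of_pos (half_pos hd')
  congr 1
  rw [show 1 / 2 * (d : ℝ) = d / 2 by ring]
  field_simp

/-- Equality of the two radial densities under `ρ = r/s`: `r/s²` is the Jacobian, and the Gamma
quotients are the sphere areas in dimensions `d` and `n`. -/
lemma gStarRadial_inversion {d n : ℕ} (hd : 0 < d) (hn : 0 < n) {r s : ℝ} (hr : 0 < r)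
    (hs : 0 < s) :
    2 * Real.pi ^ ((d : ℝ) / 2) / Real.Gamma (d / 2) *
        (r / s ^ 2 * ((r / s) ^ (d - 1) * gStarRadial d n r (r / s))) =
      2 * Real.pi ^ ((n : ℝ) / 2) / Real.Gamma (n / 2) *
        (s ^ (n - 1) * stdGaussianDensity n s) := by
  have hd' : (0 : ℝ) < d := by exact_mod_cast hd
  have hn' : (0 : ℝ) < n := by exact_mod_cast hn
  have h1 := Real.Gamma_pos_of_pos (half_pos hd')
  have h2 := Real.Gamma_pos_of_pos (half_pos hn')
  have e1 : ((r / s) ^ 2) ^ (-((n : ℝ) + d) / 2) = s ^ n * s ^ d / (r ^ n * r ^ d) := by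
    rw [← Real.rpow_natCast (r / s) 2, ← Real.rpow_mul (by positivity),
      show ((2 : ℕ) : ℝ) * (-((n : ℝ) + d) / 2) = -((n + d : ℕ) : ℝ) by push_cast; ring,
      Real.rpow_neg (by positivity), Real.rpow_natCast, div_pow, inv_div, pow_add, pow_add]
  have e2 : -r ^ 2 / (2 * (r / s) ^ 2) = -s ^ 2 / 2 := by field_simp
  have e3 : (r / √2) ^ (n : ℝ) = r ^ n / 2 ^ ((n : ℝ) / 2) := by
    rw [Real.div_rpow hr.le (by positivity), Real.rpow_natCast, Real.sqrt_eq_rpow,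
      ← Real.rpow_mul (by positivity)]
    congr 2; ring
  have e4 : (2 * Real.pi) ^ (-(n : ℝ) / 2) =
      1 / (2 ^ ((n : ℝ) / 2) * Real.pi ^ ((n : ℝ) / 2)) := by
    rw [neg_div, Real.rpow_neg (by positivity), Real.mul_rpow (by positivity) (by positivity),
      one_div]
  have e5 : Real.pi ^ (-(d : ℝ) / 2) = 1 / Real.pi ^ ((d : ℝ) / 2) := by
    rw [neg_div, Real.rpow_neg (by positivity), one_div]
  obtain ⟨d, rfl⟩ : ∃ k, d = k + 1 := ⟨d - 1, by omega⟩
  obtain ⟨n, rfl⟩ : ∃ k, n = k + 1 := ⟨n - 1, by omega⟩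
  unfold gStarRadial stdGaussianDensity
  rw [e1, e2, e3, e4, e5]
  simp only [add_tsub_cancel_right, div_pow, pow_succ]
  have := Real.pi_pos
  have p1 : 0 < Real.pi ^ (((d + 1 : ℕ) : ℝ) / 2) := by positivity
  have p2 : 0 < Real.pi ^ (((n + 1 : ℕ) : ℝ) / 2) := by positivity
  have p3 : (0 : ℝ) < 2 ^ (((n + 1 : ℕ) : ℝ) / 2) := by positivity
  field_simp

lemma image_const_div_Ioi {r : ℝ} (hr : 0 < r) :
    (fun s : ℝ => r / s) '' Set.Ioi 0 = Set.Ioi 0 := by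
  ext y
  simp only [Set.mem_image, Set.mem_Ioi]
  refine ⟨?_, fun hy => ⟨r / y, by positivity, by field_simp⟩⟩
  rintro ⟨s, hs, rfl⟩
  positivity

lemma lintegral_Ioi_const_div {r : ℝ} (hr : 0 < r) (g : ℝ → ENNReal) :
    ∫⁻ ρ in Set.Ioi (0 : ℝ), g ρ =
      ∫⁻ s in Set.Ioi (0 : ℝ), ENNReal.ofReal (r / s ^ 2) * g (r / s) := by
  conv_lhs => rw [← image_const_div_Ioi hr]
  rw [lintegral_image_eq_lintegral_abs_deriv_mul measurableSet_Ioi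
    (f' := fun s => r * -(s ^ 2)⁻¹)]
  · refine setLIntegral_congr_fun measurableSet_Ioi fun s hs => ?_
    rw [mul_neg, abs_neg, abs_of_nonneg (by positivity), ← div_eq_mul_inv]
  · intro s hs
    simpa only [div_eq_mul_inv] using
      ((hasDerivAt_inv (ne_of_gt hs)).const_mul r).hasDerivWithinAt
  · intro s hs t ht hst
    have hs : 0 < s := hs
    have ht : 0 < t := ht
    simp only at hst
    field_simp at hst
    exact hst.symm

lemma map_const_div_norm_stdGaussian {F : Type*} [NormedAddCommGroup F] [InnerProductSpace ℝ F]
    [FiniteDimensional ℝ F] [MeasurableSpace F] [BorelSpace F] {d : ℕ} (hd : 0 < d)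
    (hn : 0 < Module.finrank ℝ F) {r : ℝ} (hr : 0 < r) :
    (stdGaussian F).map (fun x => r / ‖x‖) =
      ((volume : Measure (EuclideanSpace ℝ (Fin d))).withDensity fun y =>
        ENNReal.ofReal (gStarRadial d (Module.finrank ℝ F) r ‖y‖)).map (‖·‖) := by
  have : Nontrivial F := Module.nontrivial_of_finrank_pos hn
  have : Nonempty (Fin d) := ⟨⟨0, hd⟩⟩
  refine Measure.ext_of_lintegral _ fun φ hφ => ?_
  rw [lintegral_map hφ (by fun_prop), lintegral_map hφ (by fun_prop), stdGaussian_eq_withDensity,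
    lintegral_withDensity_eq_lintegral_mul _ (by fun_prop) (by fun_prop),
    lintegral_withDensity_eq_lintegral_mul _ (by fun_prop) (by fun_prop)]
  simp only [Pi.mul_apply]
  rw [lintegral_fun_norm_addHaar volume (f := fun s =>
      ENNReal.ofReal (stdGaussianDensity (Module.finrank ℝ F) s) * φ (r / s)) (by fun_prop),
    lintegral_fun_norm_addHaar volume (f := fun s =>
      ENNReal.ofReal (gStarRadial d (Module.finrank ℝ F) r s) * φ s) (by fun_prop),
    InnerProductSpace.volume_ball, EuclideanSpace.volume_ball, finrank_euclideanSpace]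
  simp only [ENNReal.ofReal_one, one_pow, one_mul, Fintype.card_fin]
  rw [volume_ball_constant hd, volume_ball_constant hn, lintegral_Ioi_const_div hr (fun ρ =>
      ENNReal.ofReal (ρ ^ (d - 1)) *
        (ENNReal.ofReal (gStarRadial d (Module.finrank ℝ F) r ρ) * φ ρ)),
    ← lintegral_const_mul _ (by fun_prop), ← lintegral_const_mul _ (by fun_prop)]
  refine setLIntegral_congr_fun measurableSet_Ioi fun s hs => ?_
  have hs : 0 < s := hs
  have hc (k : ℕ) : 0 ≤ 2 * Real.pi ^ ((k : ℝ) / 2) / Real.Gamma (k / 2) :=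
    div_nonneg (by positivity) (Real.Gamma_nonneg_of_nonneg (by positivity))
  simp only [← mul_assoc]
  congr 1
  rw [← ENNReal.ofReal_mul (hc _), ← ENNReal.ofReal_mul (mul_nonneg (hc _) (by positivity)),
    ← ENNReal.ofReal_mul (hc _), ← ENNReal.ofReal_mul (mul_nonneg (hc _) (by positivity)),
    ← ENNReal.ofReal_mul (mul_nonneg (mul_nonneg (hc _) (by positivity)) (by positivity))]
  congr 1
  simpa only [mul_assoc] using (gStarRadial_inversion hd hn hr hs).symm

end NormLaw

/-! ### Gram-Schmidt: measurability, equivariance, last vector. -/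

section GramSchmidt

open InnerProductSpace

variable {E : Type*} [NormedAddCommGroup E] [InnerProductSpace ℝ E]
  {ι : Type*} [LinearOrder ι] [LocallyFiniteOrderBot ι] [WellFoundedLT ι]

lemma gramSchmidt_eq_sub (f : ι → E) (n : ι) :
    gramSchmidt ℝ f n = f n - ∑ i ∈ Finset.Iio n,
      (inner ℝ (gramSchmidt ℝ f i) (f n) / ‖gramSchmidt ℝ f i‖ ^ 2) • gramSchmidt ℝ f i := by
  rw [eq_sub_iff_add_eq]
  exact (gramSchmidt_def'' ℝ f n).symm

lemma measurable_gramSchmidt [MeasurableSpace E] [BorelSpace E] [SecondCountableTopology E]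
    (n : ι) : Measurable fun f : ι → E => gramSchmidt ℝ f n := by
  induction n using WellFoundedLT.induction with
  | ind n ih =>
    simp_rw [gramSchmidt_eq_sub _ n]
    refine (measurable_pi_apply n).sub (Finset.measurable_sum _ fun i hi => ?_)
    have hi := ih i (Finset.mem_Iio.1 hi)
    fun_prop

lemma gramSchmidt_map_linearIsometryEquiv (U : E ≃ₗᵢ[ℝ] E) (f : ι → E) (n : ι) :
    gramSchmidt ℝ (fun i => U (f i)) n = U (gramSchmidt ℝ f n) := by
  induction n using WellFoundedLT.induction with
  | ind n ih =>
    rw [gramSchmidt_eq_sub, gramSchmidt_eq_sub f, map_sub, map_sum]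
    congr 1
    refine Finset.sum_congr rfl fun i hi => ?_
    rw [ih i (Finset.mem_Iio.1 hi), U.inner_map_map, U.norm_map, map_smul]

/-- For fixed `b` this makes the last vector a fixed linear projection of `x`, as conditioning on
`b` requires. -/
lemma gramSchmidt_snoc_last [FiniteDimensional ℝ E] {m : ℕ} (b : Fin m → E) (x : E) :
    gramSchmidt ℝ (Fin.snoc b x : Fin (m + 1) → E) (Fin.last m) =
      (Submodule.span ℝ (Set.range b))ᗮ.starProjection x := by
  set f : Fin (m + 1) → E := Fin.snoc b x
  have hspan : Submodule.span ℝ (gramSchmidt ℝ f '' Set.Iio (Fin.last m)) =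
      Submodule.span ℝ (Set.range b) := by
    rw [span_gramSchmidt_Iio]
    congr 1
    ext y
    constructor
    · rintro ⟨i, hi, rfl⟩
      obtain ⟨j, rfl⟩ := Fin.exists_castSucc_eq.2 (ne_of_lt (Set.mem_Iio.1 hi))
      exact ⟨j, by simp [f]⟩
    · rintro ⟨j, rfl⟩
      exact ⟨j.castSucc, Fin.castSucc_lt_last j, by simp [f]⟩
  have hx : f (Fin.last m) = x := by simp [f]
  symm
  refine Submodule.eq_starProjection_of_mem_of_inner_eq_zero ?_ ?_
  · rw [← hspan, Submodule.mem_orthogonal]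
    intro u hu
    induction hu using Submodule.span_induction with
    | mem u hu =>
      obtain ⟨i, hi, rfl⟩ := hu
      exact gramSchmidt_orthogonal ℝ f (ne_of_lt hi)
    | zero => simp
    | add u v _ _ hu hv => rw [inner_add_left, hu, hv, add_zero]
    | smul a u _ hu => rw [inner_smul_left, hu, mul_zero]
  · intro w hw
    refine hw _ ?_
    rw [← hspan]
    have := gramSchmidt_def'' ℝ f (Fin.last m)
    rw [hx] at this
    rw [this, add_sub_cancel_left]
    refine Submodule.sum_mem _ fun i hi => Submodule.smul_mem _ _ (Submodule.subset_span ?_)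
    exact ⟨i, Finset.mem_Iio.1 hi, rfl⟩

end GramSchmidt

/-! ### The minimal norm solution for independent Gaussian vectors. -/

section GaussianFamily

lemma measurePreserving_snoc {E : Type*} [MeasurableSpace E] (m : ℕ) (γ : Measure E) [SigmaFinite γ] :
    MeasurePreserving (fun p : (Fin m → E) × E => (Fin.snoc p.1 p.2 : Fin (m + 1) → E))
      ((Measure.pi fun _ => γ).prod γ) (Measure.pi fun _ => γ) := by
  have h := ((measurePreserving_piFinSuccAbove (fun _ : Fin (m + 1) => γ)
    (Fin.last m)).symm (MeasurableEquiv.piFinSuccAbove (fun _ => E) (Fin.last m))).comp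
    (Measure.measurePreserving_swap (μ := Measure.pi fun _ : Fin m => γ) (ν := γ))
  convert! h using 1
  ext p
  simp [MeasurableEquiv.piFinSuccAbove, Fin.insertNthEquiv, Fin.insertNth_last']

open InnerProductSpace

variable {E : Type*} [NormedAddCommGroup E] [InnerProductSpace ℝ E]

/-- The element of least norm among the solutions `y` of the equations `⟪f i, y⟫ = 0` for
`i < m` and `⟪f m, y⟫ = r`. -/
noncomputable def minNormSolution {m : ℕ} (r : ℝ) (f : Fin (m + 1) → E) : E :=
  (r / ‖gramSchmidt ℝ f (Fin.last m)‖ ^ 2) • gramSchmidt ℝ f (Fin.last m)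

lemma norm_minNormSolution {m : ℕ} {r : ℝ} (hr : 0 ≤ r) (f : Fin (m + 1) → E) :
    ‖minNormSolution r f‖ = r / ‖gramSchmidt ℝ f (Fin.last m)‖ := by
  rw [minNormSolution, norm_smul, Real.norm_of_nonneg (by positivity)]
  -- If the vector vanishes, both sides are zero by the convention for division by zero.
  rcases eq_or_ne ‖gramSchmidt ℝ f (Fin.last m)‖ 0 with h | h
  · simp [h]
  · field_simp

variable [FiniteDimensional ℝ E]

lemma norm_adjoint_orthogonalProjectionOnto (S : Submodule ℝ E) (t : S) :
    ‖ContinuousLinearMap.adjoint S.orthogonalProjectionOnto t‖ = ‖t‖ := by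
  rw [Submodule.adjoint_orthogonalProjectionOnto]
  simp

variable [MeasurableSpace E] [BorelSpace E]

/-- Fewer than `finrank ℝ E` vectors span a proper subspace, which is null for the next Gaussian
vector. -/
lemma ae_linearIndependent_pi_stdGaussian (m : ℕ) (hm : m ≤ Module.finrank ℝ E) :
    ∀ᵐ f ∂(Measure.pi fun _ : Fin m => stdGaussian E), LinearIndependent ℝ f := by
  induction m with
  | zero => exact .of_forall fun f => linearIndependent_empty_type
  | succ m ih =>
    have hp := measurePreserving_snoc m (stdGaussian E)
    have hs : MeasurableSet {f : Fin (m + 1) → E | LinearIndependent ℝ f} :=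
      isOpen_setOfPred_linearIndependent.measurableSet
    rw [← hp.map_eq, ae_map_iff hp.measurable.aemeasurable hs]
    refine (Measure.ae_prod_iff_ae_ae (hs.preimage hp.measurable)).2 ?_
    filter_upwards [ih (by omega)] with b hb
    have : Submodule.span ℝ (Set.range b) ≠ ⊤ := fun h => by
      have := finrank_span_eq_card hb
      rw [h, finrank_top, Fintype.card_fin] at this
      omega
    filter_upwards [measure_eq_zero_iff_ae_notMem.1 (stdGaussian_submodule_eq_zero _ this)]
      with x hx
    exact linearIndependent_finSnoc.2 ⟨hb, hx⟩

lemma measurable_minNormSolution {m : ℕ} (r : ℝ) :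
    Measurable (minNormSolution r : (Fin (m + 1) → E) → E) := by
  have := measurable_gramSchmidt (E := E) (Fin.last m)
  unfold minNormSolution
  fun_prop

lemma map_minNormSolution_rotation {m : ℕ} (r : ℝ) (U : E ≃ₗᵢ[ℝ] E) :
    ((Measure.pi fun _ : Fin (m + 1) => stdGaussian E).map (minNormSolution r)).map U =
      (Measure.pi fun _ : Fin (m + 1) => stdGaussian E).map (minNormSolution r) := by
  have hU : MeasurePreserving (fun (f : Fin (m + 1) → E) i => U (f i))
      (Measure.pi fun _ => stdGaussian E) (Measure.pi fun _ => stdGaussian E) :=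
    measurePreserving_pi _ _ fun _ => ⟨by fun_prop, stdGaussian_map U⟩
  have hmeas := measurable_minNormSolution (E := E) (m := m) r
  conv_rhs => rw [← hU.map_eq]
  rw [Measure.map_map (by fun_prop) hmeas, Measure.map_map hmeas hU.measurable]
  congr 1
  ext1 f
  simp only [Function.comp_apply, minNormSolution, gramSchmidt_map_linearIsometryEquiv, map_smul,
    U.norm_map]

lemma map_norm_map_minNormSolution {d m n : ℕ} (hd : 0 < d) (hn : 0 < n)
    (hE : Module.finrank ℝ E = n + m) {r : ℝ} (hr : 0 < r) :
    ((Measure.pi fun _ : Fin (m + 1) => stdGaussian E).map (minNormSolution r)).map (‖·‖) =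
      ((volume : Measure (EuclideanSpace ℝ (Fin d))).withDensity fun y =>
        ENNReal.ofReal (gStarRadial d n r ‖y‖)).map (‖·‖) := by
  refine Measure.ext_of_lintegral _ fun φ hφ => ?_
  have hp := measurePreserving_snoc m (stdGaussian E)
  have hmeas := measurable_minNormSolution (E := E) (m := m) r
  rw [lintegral_map hφ (by fun_prop), lintegral_map (by fun_prop) hmeas,
    ← hp.lintegral_comp (by fun_prop)]
  refine (lintegral_prod _
    (hφ.comp (measurable_norm.comp (hmeas.comp hp.measurable))).aemeasurable).trans ?_
  -- For almost every `b` the inner integral has the same value: only the dimension of the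
  -- orthogonal complement of the span of `b` matters.
  refine (lintegral_congr_ae (g := fun _ => ∫⁻ ρ, φ ρ ∂((volume.withDensity fun y :
    EuclideanSpace ℝ (Fin d) => ENNReal.ofReal (gStarRadial d n r ‖y‖)).map (‖·‖))) ?_).trans
      (by simp)
  filter_upwards [ae_linearIndependent_pi_stdGaussian m (by omega)] with b hb
  set S := (Submodule.span ℝ (Set.range b))ᗮ
  have hS : Module.finrank ℝ S = n := by
    have h1 := Submodule.finrank_add_finrank_orthogonal (Submodule.span ℝ (Set.range b))
    have h2 := finrank_span_eq_card hb
    rw [Fintype.card_fin] at h2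
    change _ + Module.finrank ℝ S = _ at h1
    omega
  subst hS
  rw [← map_const_div_norm_stdGaussian hd hn hr,
    ← stdGaussian_map_of_norm_adjoint S.orthogonalProjectionOnto
      (norm_adjoint_orthogonalProjectionOnto S), lintegral_map hφ (by fun_prop),
    lintegral_map (by fun_prop) (by fun_prop)]
  refine lintegral_congr fun x => ?_
  simp only [Function.comp_apply]
  rw [norm_minNormSolution hr.le, gramSchmidt_snoc_last]
  rfl

/-- The law of the minimal norm solution of a system of Gaussian linear equations. -/
theorem map_minNormSolution {d m n : ℕ} (hn : 0 < n) (hd : d = n + m) {r : ℝ} (hr : 0 < r) :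
    (Measure.pi fun _ : Fin (m + 1) => stdGaussian (EuclideanSpace ℝ (Fin d))).map
      (minNormSolution r) = (volume : Measure (EuclideanSpace ℝ (Fin d))).withDensity fun y =>
        ENNReal.ofReal (gStarRadial d n r ‖y‖) := by
  have hd' : 0 < d := by omega
  have : Nonempty (Fin d) := ⟨⟨0, hd'⟩⟩
  have hnorm := map_norm_map_minNormSolution (E := EuclideanSpace ℝ (Fin d)) hd' hn
    (by rw [finrank_euclideanSpace_fin, hd]) hr
  have hprob : IsProbabilityMeasure ((Measure.pi fun _ : Fin (m + 1) =>
      stdGaussian (EuclideanSpace ℝ (Fin d))).map (minNormSolution r)) :=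
    Measure.isProbabilityMeasure_map (measurable_minNormSolution r).aemeasurable
  -- The total mass is read off from the equality of norm laws, without integrating `g*`.
  have hfin : IsFiniteMeasure ((volume : Measure (EuclideanSpace ℝ (Fin d))).withDensity fun y =>
      ENNReal.ofReal (gStarRadial d n r ‖y‖)) := by
    have := congr($hnorm Set.univ)
    rw [Measure.map_apply (by fun_prop) .univ, Measure.map_apply (by fun_prop) .univ,
      Set.preimage_univ] at this
    exact ⟨this ▸ measure_lt_top _ _⟩
  refine eq_of_map_norm_eq_of_rotation_invariant (map_minNormSolution_rotation r) ?_ hnorm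
  exact withDensity_fun_norm_map_linearIsometryEquiv _ (by fun_prop) fun v w h => by rw [h]

end GaussianFamily

/-! ### Existence and uniqueness of the minimal norm element. -/

section MinimalNorm

open InnerProductSpace

variable {d m : ℕ}

lemma inner_gramSchmidt_last_eq {r : ℝ} {f : Fin (m + 1) → EuclideanSpace ℝ (Fin d)}
    {y : EuclideanSpace ℝ (Fin d)}
    (hy : ∀ k, inner ℝ (f k) y = if k = Fin.last m then r else 0) :
    inner ℝ (gramSchmidt ℝ f (Fin.last m)) y = r := by
  rw [← Fin.snoc_init_self f, gramSchmidt_snoc_last, Submodule.inner_starProjection_left_eq_right,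
    Submodule.starProjection_eq_self_iff.2, hy, if_pos rfl]
  rw [Submodule.mem_orthogonal]
  intro u hu
  induction hu using Submodule.span_induction with
  | mem u hu =>
    obtain ⟨i, rfl⟩ := hu
    exact (hy i.castSucc).trans (if_neg (Fin.castSucc_lt_last i).ne)
  | zero => simp
  | add u v _ _ hu hv => rw [inner_add_left, hu, hv, add_zero]
  | smul a u _ hu => rw [inner_smul_left, hu, mul_zero]

lemma inner_gramSchmidt_last (f : Fin (m + 1) → EuclideanSpace ℝ (Fin d)) (k : Fin (m + 1)) :
    inner ℝ (f k) (gramSchmidt ℝ f (Fin.last m)) =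
      if k = Fin.last m then ‖gramSchmidt ℝ f (Fin.last m)‖ ^ 2 else 0 := by
  rw [← real_inner_self_eq_norm_sq]
  rw [← Fin.snoc_init_self f, gramSchmidt_snoc_last]
  set S := (Submodule.span ℝ (Set.range (Fin.init f)))
  refine Fin.lastCases ?_ (fun i => ?_) k
  · rw [if_pos rfl, Fin.snoc_last, Submodule.inner_starProjection_left_eq_right,
      Submodule.starProjection_eq_self_iff.2 (Submodule.starProjection_apply_mem _ _)]
  · rw [if_neg (Fin.castSucc_lt_last i).ne, Fin.snoc_castSucc]
    exact Submodule.starProjection_apply_mem Sᗮ _ _ (Submodule.subset_span ⟨i, rfl⟩)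

/-- All points of `S` have the same inner product with `minNormSolution r f`, so Pythagoras gives
both minimality and uniqueness. -/
lemma existsUnique_isMinimalNormElement {r : ℝ} {f : Fin (m + 1) → EuclideanSpace ℝ (Fin d)}
    (hf : gramSchmidt ℝ f (Fin.last m) ≠ 0) {S : Set (EuclideanSpace ℝ (Fin d))}
    (hS : ∀ y, y ∈ S ↔ ∀ k, inner ℝ (f k) y = if k = Fin.last m then r else 0) :
    IsMinimalNormElement S (minNormSolution r f) ∧
      ∀ y, IsMinimalNormElement S y → y = minNormSolution r f := by
  have hw := norm_ne_zero_iff.2 hf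
  have hmem : minNormSolution r f ∈ S := by
    rw [hS]
    intro k
    rw [minNormSolution, inner_smul_right, inner_gramSchmidt_last]
    split_ifs
    · field_simp
    · simp
  have hinner : ∀ y ∈ S, inner ℝ y (minNormSolution r f) = ‖minNormSolution r f‖ ^ 2 := by
    have h : ∀ y ∈ S, inner ℝ y (minNormSolution r f) =
        r / ‖gramSchmidt ℝ f (Fin.last m)‖ ^ 2 * r := fun y hy => by
      rw [minNormSolution, inner_smul_right, real_inner_comm,
        inner_gramSchmidt_last_eq ((hS y).1 hy)]
    intro y hy
    rw [h y hy, ← h _ hmem, real_inner_self_eq_norm_sq]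
  have hdist : ∀ y ∈ S, ‖y - minNormSolution r f‖ ^ 2 = ‖y‖ ^ 2 - ‖minNormSolution r f‖ ^ 2 := by
    intro y hy
    rw [norm_sub_sq_real, hinner y hy]
    ring
  refine ⟨⟨hmem, fun y hy => ?_⟩, fun y hy => ?_⟩
  · exact le_of_sq_le_sq (by linarith [hdist y hy, sq_nonneg ‖y - minNormSolution r f‖])
      (norm_nonneg _)
  · have h1 := hdist y hy.1
    have h2 := pow_le_pow_left₀ (norm_nonneg _) (hy.2 _ hmem) 2
    have h3 : ‖y - minNormSolution r f‖ ^ 2 = 0 := le_antisymm (by linarith) (sq_nonneg _)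
    exact sub_eq_zero.1 (norm_eq_zero.1 (pow_eq_zero_iff two_ne_zero |>.1 h3))

end MinimalNorm

/-! ### Row combinations of a Gaussian matrix. -/

section GaussianMatrix

variable {Ω : Type*} [MeasurableSpace Ω] {P : Measure Ω} [IsProbabilityMeasure P] {D d : ℕ}
  {A : Ω → Matrix (Fin D) (Fin d) ℝ}

/-- The combination of the rows of `A` whose coefficients are the coordinates of `u`. -/
noncomputable def rowCombination (A : Matrix (Fin D) (Fin d) ℝ) (u : EuclideanSpace ℝ (Fin D)) :
    EuclideanSpace ℝ (Fin d) :=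
  WithLp.toLp 2 (u.ofLp ᵥ* A)

lemma inner_rowCombination (A : Matrix (Fin D) (Fin d) ℝ) (u : EuclideanSpace ℝ (Fin D))
    (y : EuclideanSpace ℝ (Fin d)) :
    inner ℝ (rowCombination A u) y = inner ℝ u (WithLp.toLp 2 (A *ᵥ y.ofLp)) := by
  simp only [EuclideanSpace.inner_eq_star_dotProduct, rowCombination, star_trivial]
  rw [dotProduct_comm, dotProduct_comm _ u.ofLp, Matrix.dotProduct_mulVec]

omit [IsProbabilityMeasure P] in
lemma IsGaussianMatrix.aemeasurable_rowCombination (hA : IsGaussianMatrix A P)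
    (u : EuclideanSpace ℝ (Fin D)) : AEMeasurable (fun ω => rowCombination (A ω) u) P := by
  refine (WithLp.measurable_toLp 2 _).comp_aemeasurable (aemeasurable_pi_lambda _ fun j => ?_)
  simp only [Matrix.vecMul, dotProduct]
  exact Finset.aemeasurable_fun_sum _ fun i _ => ((hA.hasLaw i j).aemeasurable.const_mul _)

lemma IsGaussianMatrix.map_entries (hA : IsGaussianMatrix A P) :
    P.map (fun ω => WithLp.toLp 2 fun p : Fin D × Fin d => A ω p.1 p.2) =
      stdGaussian (EuclideanSpace ℝ (Fin D × Fin d)) := by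
  have hm : ∀ p : Fin D × Fin d, AEMeasurable (fun ω => A ω p.1 p.2) P :=
    fun p => (hA.hasLaw p.1 p.2).aemeasurable
  have h := (iIndepFun_iff_map_fun_eq_pi_map hm).1 hA.indep
  simp_rw [(hA.hasLaw _ _).map_eq] at h
  rw [← map_pi_eq_stdGaussian, ← h,
    AEMeasurable.map_map_of_aemeasurable (by fun_prop) (aemeasurable_pi_lambda _ hm)]
  rfl

lemma Orthonormal.norm_sq_sum_mul {ι : Type*} [Fintype ι] {u : ι → EuclideanSpace ℝ (Fin D)}
    (hu : Orthonormal ℝ u) (t : ι → EuclideanSpace ℝ (Fin d)) :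
    ‖(WithLp.toLp 2 fun p : Fin D × Fin d => ∑ k, u k p.1 * t k p.2 :
      EuclideanSpace ℝ (Fin D × Fin d))‖ ^ 2 = ∑ k, ‖t k‖ ^ 2 := by
  simp_rw [EuclideanSpace.real_norm_sq_eq]
  rw [Fintype.sum_prod_type_right]
  refine Eq.trans (Finset.sum_congr rfl fun j _ => ?_) Finset.sum_comm
  have h := hu.inner_sum (fun k => t k j) (fun k => t k j) Finset.univ
  rw [real_inner_self_eq_norm_sq, EuclideanSpace.real_norm_sq_eq] at h
  simp only [WithLp.ofLp_sum, WithLp.ofLp_smul, Finset.sum_apply, Pi.smul_apply, smul_eq_mul,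
    conj_trivial, ← sq] at h
  simp_rw [← h, mul_comm]

/-- Combinations of the rows of a Gaussian matrix along an orthonormal family are independent
standard Gaussian vectors. -/
lemma IsGaussianMatrix.map_rowCombination (hA : IsGaussianMatrix A P) {ι : Type*} [Fintype ι]
    {u : ι → EuclideanSpace ℝ (Fin D)} (hu : Orthonormal ℝ u) :
    P.map (fun ω k => rowCombination (A ω) (u k)) =
      Measure.pi fun _ => stdGaussian (EuclideanSpace ℝ (Fin d)) := by
  have hR : AEMeasurable (fun ω k => rowCombination (A ω) (u k)) P :=
    aemeasurable_pi_lambda _ fun k => hA.aemeasurable_rowCombination (u k)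
  have hX : AEMeasurable (fun ω => (WithLp.toLp 2 fun p : Fin D × Fin d => A ω p.1 p.2 :
      EuclideanSpace ℝ (Fin D × Fin d))) P :=
    (WithLp.measurable_toLp 2 _).comp_aemeasurable
      (aemeasurable_pi_lambda _ fun p => (hA.hasLaw p.1 p.2).aemeasurable)
  have := Measure.isProbabilityMeasure_map hR
  refine charFun_eq_pi_iff.1 fun t => ?_
  -- The joint characteristic function at `t` is that of the matrix entries at `∑ k, u k ⊗ t k`,
  -- whose squared norm splits as `∑ k, ‖t k‖ ^ 2`.
  have hs := charFun_stdGaussian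
    (WithLp.toLp 2 fun p : Fin D × Fin d => ∑ k, u k p.1 * t k p.2)
  rw [← hA.map_entries, charFun_apply, integral_map hX (by fun_prop), ← Complex.ofReal_pow,
    hu.norm_sq_sum_mul] at hs
  rw [AEMeasurable.map_map_of_aemeasurable (by fun_prop) hR, charFun_apply,
    integral_map (AEMeasurable.comp_aemeasurable (by fun_prop) hR) (by fun_prop)]
  simp_rw [charFun_stdGaussian, ← Complex.exp_sum]
  convert! hs using 1
  · congr 1
    ext ω
    congr 3
    simp only [Function.comp_apply, PiLp.inner_apply, rowCombination, Matrix.vecMul, dotProduct,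
      RCLike.inner_apply, conj_trivial]
    rw [Fintype.sum_prod_type]
    simp_rw [Finset.sum_mul, Finset.mul_sum]
    rw [Finset.sum_comm]
    refine (Finset.sum_congr rfl fun j _ => Finset.sum_comm).trans (Finset.sum_comm.trans ?_)
    refine Finset.sum_congr rfl fun i _ => Finset.sum_congr rfl fun j _ =>
      Finset.sum_congr rfl fun k _ => ?_
    ring
  · congr 1
    push_cast
    rw [← Finset.sum_div, Finset.sum_neg_distrib]

end GaussianMatrix

/-! ### Reduction to Gaussian linear equations and conclusion. -/

section MainTheorem

lemma exists_orthonormalBasis_last {V : Type*} [NormedAddCommGroup V] [InnerProductSpace ℝ V]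
    [FiniteDimensional ℝ V] {m : ℕ} (hV : Module.finrank ℝ V = m + 1) {e : V} (he : ‖e‖ = 1) :
    ∃ b : OrthonormalBasis (Fin (m + 1)) ℝ V, b (Fin.last m) = e := by
  obtain ⟨b, hb⟩ := Orthonormal.exists_orthonormalBasis_extension_of_card_eq
    (ι := Fin (m + 1)) (𝕜 := ℝ) (by simpa using hV) (v := fun _ => e) (s := {Fin.last m})
    ⟨fun _ => he, fun i j hij => (hij (Subsingleton.elim i j)).elim⟩
  exact ⟨b, hb _ rfl⟩

lemma mem_reducedMinimizers_iff {D d : ℕ} {ι : Type*} [Fintype ι]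
    (A : Matrix (Fin D) (Fin d) ℝ) (T : Submodule ℝ (EuclideanSpace ℝ (Fin D)))
    (xs : EuclideanSpace ℝ (Fin D)) (b : OrthonormalBasis ι ℝ T) (y : EuclideanSpace ℝ (Fin d)) :
    y ∈ reducedMinimizers A T xs ↔ ∀ k, inner ℝ (rowCombination A (b k)) y =
      inner ℝ (b k : EuclideanSpace ℝ (Fin D)) (T.starProjection xs) := by
  simp_rw [inner_rowCombination]
  constructor
  · rintro ⟨v, hv, h⟩ k
    rw [h, inner_add_right, hv _ (b k).2, add_zero]
  · intro h
    refine ⟨WithLp.toLp 2 (A *ᵥ y.ofLp) - T.starProjection xs, fun x hx => ?_, by abel⟩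
    have hx' : x = ∑ k, b.repr ⟨x, hx⟩ k • (b k : EuclideanSpace ℝ (Fin D)) := by
      have := congr(($(b.sum_repr ⟨x, hx⟩) : EuclideanSpace ℝ (Fin D)))
      simpa using this.symm
    rw [hx', sum_inner]
    refine Finset.sum_eq_zero fun k _ => ?_
    rw [inner_smul_left, inner_sub_right, h, sub_self, mul_zero]

theorem mainTheorem2 {Ω : Type*} [MeasurableSpace Ω] (P : Measure Ω) [IsProbabilityMeasure P]
    (D d de : ℕ) (hde : de ≤ d)
    (f : EuclideanSpace ℝ (Fin D) → ℝ) (hf : Continuous f)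
    (T : Submodule ℝ (EuclideanSpace ℝ (Fin D))) (hT : IsEffectiveSubspace f de T)
    (xs : EuclideanSpace ℝ (Fin D)) (hxs : ∀ x, f xs ≤ f x)
    (hxT : T.starProjection xs ≠ 0)
    (A : Ω → Matrix (Fin D) (Fin d) ℝ) (hA : IsGaussianMatrix A P) :
    (∀ᵐ ω ∂P, ∃! y, IsMinimalNormElement (reducedMinimizers (A ω) T xs) y) ∧
    ∀ y₂ : Ω → EuclideanSpace ℝ (Fin d),
      (∀ᵐ ω ∂P, IsMinimalNormElement (reducedMinimizers (A ω) T xs) (y₂ ω)) →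
      HasPDF y₂ P volume ∧
      pdf y₂ P volume =ᵐ[volume] fun y => ENNReal.ofReal (gStar de ‖T.starProjection xs‖ y) := by
  set x := T.starProjection xs with hx
  have hxmem : x ∈ T := Submodule.starProjection_apply_mem _ _
  have hr : 0 < ‖x‖ := norm_pos_iff.2 hxT
  have hde0 : 0 < de := by
    rw [← hT.finrank_eq]
    have : Nontrivial T := ⟨⟨⟨x, hxmem⟩, 0, fun h => hxT (congr_arg Subtype.val h)⟩⟩
    exact Module.finrank_pos
  obtain ⟨m, rfl⟩ : ∃ m, de = m + 1 := ⟨de - 1, by omega⟩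
  -- As `de = m + 1`, this `n` is `d - de + 1`, and `de ≤ d` makes it positive.
  obtain ⟨n, rfl⟩ : ∃ n, d = n + m := ⟨d - m, by omega⟩
  obtain ⟨b, hb⟩ := exists_orthonormalBasis_last hT.finrank_eq
    (e := ‖x‖⁻¹ • (⟨x, hxmem⟩ : T)) (by
      rw [norm_smul, norm_inv, norm_norm, Submodule.coe_norm, inv_mul_cancel₀ hr.ne'])
  have hu : Orthonormal ℝ fun k => (b k : EuclideanSpace ℝ (Fin D)) :=
    b.orthonormal.comp_linearIsometry T.subtypeₗᵢ
  have hbx : ∀ k, inner ℝ (b k : EuclideanSpace ℝ (Fin D)) x =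
      if k = Fin.last m then ‖x‖ else 0 := by
    intro k
    have hxb : x = ‖x‖ • (b (Fin.last m) : EuclideanSpace ℝ (Fin D)) := by
      rw [hb, Submodule.coe_smul, smul_smul, mul_inv_cancel₀ hr.ne', one_smul]
    conv_lhs => rw [hxb]
    rw [inner_smul_right, orthonormal_iff_ite.1 hu]
    split_ifs <;> simp
  set R : Ω → Fin (m + 1) → EuclideanSpace ℝ (Fin (n + m)) :=
    fun ω k => rowCombination (A ω) (b k)
  have hR : AEMeasurable R P := aemeasurable_pi_lambda _ fun k => hA.aemeasurable_rowCombination _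
  have hlaw : P.map R = Measure.pi fun _ => stdGaussian (EuclideanSpace ℝ (Fin (n + m))) :=
    hA.map_rowCombination hu
  have hind : ∀ᵐ ω ∂P, LinearIndependent ℝ (R ω) := by
    have := ae_linearIndependent_pi_stdGaussian (E := EuclideanSpace ℝ (Fin (n + m))) (m + 1)
      (by rw [finrank_euclideanSpace_fin]; exact hde)
    rw [← hlaw] at this
    exact ae_of_ae_map hR this
  have hmin : ∀ᵐ ω ∂P,
      IsMinimalNormElement (reducedMinimizers (A ω) T xs) (minNormSolution ‖x‖ (R ω)) ∧
      ∀ y, IsMinimalNormElement (reducedMinimizers (A ω) T xs) y →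
        y = minNormSolution ‖x‖ (R ω) := by
    filter_upwards [hind] with ω hω
    refine existsUnique_isMinimalNormElement
      (InnerProductSpace.gramSchmidt_ne_zero (Fin.last m) hω) fun y => ?_
    rw [mem_reducedMinimizers_iff (A ω) T xs b y]
    simp_rw [← hx, hbx]
    rfl
  refine ⟨hmin.mono fun ω hω => ⟨_, hω.1, hω.2⟩, fun y₂ hy₂ => ?_⟩
  have hy : y₂ =ᵐ[P] fun ω => minNormSolution ‖x‖ (R ω) := by
    filter_upwards [hmin, hy₂] with ω h1 h2 using h1.2 _ h2
  have hmeas := measurable_minNormSolution (E := EuclideanSpace ℝ (Fin (n + m))) (m := m) ‖x‖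
  -- Measurability of `y₂` is inherited from the explicit solution, to which it is almost surely
  -- equal.
  have hym : AEMeasurable y₂ P := (hmeas.comp_aemeasurable hR).congr hy.symm
  have hg : (fun y => ENNReal.ofReal (gStar (m + 1) ‖x‖ y)) =
      fun y : EuclideanSpace ℝ (Fin (n + m)) =>
        ENNReal.ofReal (gStarRadial (n + m) n ‖x‖ ‖y‖) := by
    ext y
    rw [gStar_eq_gStarRadial (n := n) (by ring)]
  have hmap : P.map y₂ = volume.withDensity fun y => ENNReal.ofReal (gStar (m + 1) ‖x‖ y) := by
    rw [hg, Measure.map_congr hy, ← map_minNormSolution (by omega) rfl hr, ← hlaw,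
      AEMeasurable.map_map_of_aemeasurable hmeas.aemeasurable hR]
    rfl
  have hgm : AEMeasurable (fun y : EuclideanSpace ℝ (Fin (n + m)) =>
      ENNReal.ofReal (gStar (m + 1) ‖x‖ y)) volume := by
    rw [hg]
    fun_prop
  have hpdf : HasPDF y₂ P volume := hasPDF_of_map_eq_withDensity hym _ hgm hmap
  exact ⟨hpdf, pdf.eq_of_map_eq_withDensity _ hgm |>.1 hmap⟩

end MainTheorem
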